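/- Let $G=(V,E)$ be a finite planar graph with a fixed planar embedding, and let $G^*=(V^*,E^*)$ be its dual multigraph (loops and parallel edges allowed): its vertices are the faces of $G$, and every edge $e\in E$ has a dual edge $e^*\in E^*$ joining the two (possibly equal) faces on the two sides of $e$. Let $\sigma:V\to 2^{[m]}$ be a coloring that is color-connected: for each color $c\in[m]$, the subgraph of $G$ induced by $\{v\in V: c\in\sigma(v)\}$ is connected (or empty). For $e=uv\in E$ put $\sigma(e^*)=\sigma(e)=\sigma(u)\cup\sigma(v)$. Let $s,t\in V$ be two vertices that are connected in $G$. A set $S\subseteq[m]$ is an $s$-$t$ color separator if, with $V(S)=\{v\in V:\sigma(v)\cap S\neq\emptyset\}$, the vertices $s,t$ do not lie in $V(S)$ and lie in distinct connected components of $G-V(S)$. Then for every $s$-$t$ color separator $S$ there exist a simple cycle $\gamma$ in $G^*$, with vertices $v_1^*\to v_2^*\to\cdots\to v_r^*\to v_1^*$ ($r\ge 1$, a loop being a cycle of length $1$ and two parallel edges forming a cycle of length $2$) and edges $e_i^*$ joining $v_{i-1}^*$ to $v_i^*$ (indices modulo $r$), and a labeling $\lambda:V^*\to S$, such that 1. $\gamma$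 separates $s$ from $t$: every $s$-$t$ path in $G$ uses an edge whose dual edge belongs to $\gamma$; 2. $\lambda$ comes from a labeling of the edges of $\gamma$ by their own colors: for some $\lambda:E^*\to S$ with $\lambda(e_i^*)\in\sigma(e_i^*)\cap S$ for all $i$, one has $\lambda(v_i^*)=\lambda(e_i^*)$ for all $i$; 3. the color-cycle $\lambda(\gamma)=\lambda(v_1^*)\to\lambda(v_2^*)\to\cdots\to\lambda(v_r^*)\to\lambda(v_1^*)$ is well-behaved: for every color $c$, all occurrences of $c$ in this cyclic sequence are consecutive. -/

import Mathlib

universe u v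

/-- An embedding of the graph `G` in the plane (equivalently, in the sphere), up to homeomorphism,
with set of faces `F`. It is given by its rotation system and by the assignment, to each dart,
of the face lying on its left. The graph may be disconnected, in which case the boundary of a face
may consist of several closed walks. That the surface is a sphere is expressed by Euler's formula
`|V| - |E| + |F| = 1 + (number of connected components)`. -/
structure PlaneEmbedding {V : Type u} (G : SimpleGraph V) (F : Type v) where
  /-- `rot d` is the dart that follows `d` in the clockwise order around the source of `d`. -/
  rot : Equiv.Perm G.Dart
  rot_fst : ∀ d, (rot d).fst = d.fst
  /-- the darts leaving a vertex form a single cycle of the rotation -/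
  rot_sameCycle : ∀ d d' : G.Dart, d.fst = d'.fst → rot.SameCycle d d'
  /-- the face on the left of a dart -/
  left : G.Dart → F
  /-- Walking along `d` and then along the clockwise successor of its reverse,
  one keeps the same face on the left. -/
  left_rot_symm : ∀ d, left (rot d.symm) = left d
  /-- Any two faces can be joined by successively crossing edges. -/
  faces_connected : ∀ f g : F,
    Relation.ReflTransGen (fun a b => ∃ d : G.Dart, left d = a ∧ left d.symm = b) f g
  /-- Euler's formula -/
  euler : Nat.card V + Nat.card F = Nat.card G.edgeSet + Nat.card G.ConnectedComponent + 1

/-- The dual multigraph: its vertices are the faces, its edges are the edges of `G` (an edge `e` of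
`G` standing for its dual edge), and the dual edge of `e` joins the faces on both sides of `e`.
It may have loops and parallel edges. -/
def PlaneEmbedding.dual {V : Type u} {G : SimpleGraph V} {F : Type v} (P : PlaneEmbedding G F) :
    Graph F (Sym2 V) where
  vertexSet := Set.univ
  IsLink e f g := ∃ d : G.Dart, d.edge = e ∧ P.left d = f ∧ P.left d.symm = g
  edgeSet := G.edgeSet
  isLink_symm := by
    intro e _
    constructor
    rintro x y ⟨d, hd, rfl, rfl⟩
    exact ⟨d.symm, by rw [SimpleGraph.Dart.edge_symm, hd], rfl,
      by rw [SimpleGraph.Dart.symm_symm]⟩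
  eq_or_eq_of_isLink_of_isLink := by
    rintro e x y z w ⟨d, hd, rfl, rfl⟩ ⟨d', hd', rfl, rfl⟩
    rcases (SimpleGraph.dart_edge_eq_iff d d').1 (hd.trans hd'.symm) with rfl | rfl
    · exact Or.inl rfl
    · exact Or.inr rfl
  edge_mem_iff_exists_isLink := by
    intro e
    constructor
    · intro he
      induction e with
      | _ a b => exact ⟨_, _, ⟨(a, b), he⟩, rfl, rfl, rfl⟩
    · rintro ⟨_, _, d, rfl, -, -⟩
      exact d.edge_mem
  left_mem_of_isLink := by
    intros
    exact Set.mem_univ _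

/-- A (simple) cycle of length `k + 1` in a multigraph: pairwise distinct vertices
`vert 0, …, vert k` and pairwise distinct edges `edge 0, …, edge k`, where `edge i` joins
`vert (i - 1)` to `vert i`, indices being taken modulo `k + 1`.
A loop is a cycle of length one and two parallel edges form a cycle of length two. -/
structure DualCycle {F : Type u} {E : Type v} (H : Graph F E) where
  k : ℕ
  vert : Fin (k + 1) → F
  edge : Fin (k + 1) → E
  vert_injective : Function.Injective vert
  edge_injective : Function.Injective edge
  isLink : ∀ i, H.IsLink (edge i) (vert (i - 1)) (vert i)

/-- The cycle `γ` of the dual graph separates `s` from `t`: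
every path from `s` to `t` in `G` uses an edge that is crossed by `γ`. -/
def Separates {V : Type u} {G : SimpleGraph V} {F : Type v} {P : PlaneEmbedding G F}
    (γ : DualCycle P.dual) (s t : V) : Prop :=
  ¬ (G.deleteEdges (Set.range γ.edge)).Reachable s t

/-- The set of vertices that contain a color in `S`. -/
def hostSet {V : Type u} {m : ℕ} (σ : V → Set (Fin m)) (S : Set (Fin m)) : Set V :=
  {v | (σ v ∩ S).Nonempty}

/-- Every color `c` is connected: the vertices containing `c` induce a connected
(possibly empty) subgraph. -/
def ColorConnected {V : Type u} (G : SimpleGraph V) {m : ℕ} (σ : V → Set (Fin m)) : Prop :=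
  ∀ c : Fin m, (G.induce {v | c ∈ σ v}).Preconnected

/-- `S` is an `s`-`t` color separator: `s` and `t` lie in distinct connected components of
the graph obtained by deleting the vertices that contain a color in `S`. -/
def IsColorSeparator {V : Type u} (G : SimpleGraph V) {m : ℕ} (σ : V → Set (Fin m)) (s t : V)
    (S : Set (Fin m)) : Prop :=
  ∃ (hs : s ∈ (hostSet σ S)ᶜ) (ht : t ∈ (hostSet σ S)ᶜ),
    ¬ (G.induce (hostSet σ S)ᶜ).Reachable ⟨s, hs⟩ ⟨t, ht⟩

/-- The colors of an edge, and of its dual edge, are those of its two endpoints. -/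
def edgeColors {V : Type u} {m : ℕ} (σ : V → Set (Fin m)) (e : Sym2 V) : Set (Fin m) :=
  {c | ∃ v ∈ e, c ∈ σ v}

/-- `lam` is a labeling of the vertices of the dual cycle `γ` by colors of `S`: it comes from a
labeling `lamE` of dual edges which assigns to each edge of `γ` a color of `S` contained in that
edge, by giving each vertex of `γ` the label of the edge of `γ` preceding it. -/
def IsLabeling {V : Type u} {G : SimpleGraph V} {F : Type v} {P : PlaneEmbedding G F} {m : ℕ}
    (σ : V → Set (Fin m)) (S : Set (Fin m)) (γ : DualCycle P.dual) (lam : F → S) : Prop :=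
  ∃ lamE : Sym2 V → S,
    (∀ i, (lamE (γ.edge i) : Fin m) ∈ edgeColors σ (γ.edge i)) ∧
    ∀ i, lam (γ.vert i) = lamE (γ.edge i)

/-- A cyclic sequence is well-behaved if, for each `c`, all occurrences of `c` are consecutive:
they are exactly the first `n` positions `a, a + 1, …, a + n - 1` (taken modulo `k + 1`) from
some position `a` on. -/
def WellBehaved {C : Type u} {k : ℕ} (Z : Fin (k + 1) → C) : Prop :=
  ∀ c : C, ∃ (a : Fin (k + 1)) (n : ℕ), ∀ i, Z i = c ↔ ((i - a : Fin (k + 1)) : ℕ) < n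

/-! Work over `ZMod 2`. Let `w` be the edge vector of an `s`-`t` path and call a closed dual walk
odd if it crosses this path an odd number of times. Use only dual edges carrying a color of `S`,
with one parallel copy for each such color.

An odd closed walk exists (`exists_odd_closed_walk`). Otherwise, on edges meeting `S`, `w` is the
difference of a face potential `p`. The component of `s` in `G - V(S)` has a coboundary supported on
such edges; `w` pairs with it to 1, whereas the potential pairs with it to 0, since a coboundary
meets every face boundary evenly.

An odd closed walk separates (`not_reachable_of_odd_closed_walk`). Its edge vector meets every face
boundary evenly, so by Euler's formula it is the coboundary of some `h`, with `h s + h t = 1`. But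
`h` is constant along any path avoiding the walk.

Now shorten (`exists_wellBehaved_cycle`). At a repeated face, split the walk into two closed walks.
If a color recurs after an interruption, join its two occurrences by a dual walk of that color,
available because color classes stay connected in the dual (`joined_of_mem_edgeColors`); this chord
again splits the walk in two. Gains add and the chord counts twice, so one piece is odd. Each
replacement lowers the pair (color changes, length) lexicographically, so the process ends at a
well-behaved simple cycle. -/

/-- A directed multigraph closed under reversal of arcs, whose arcs carry a color and a gain
in `ZMod 2`, both invariant under reversal. -/
structure GainGraph (F : Type*) (C : Type*) where
  Arc : Type*
  src : Arc → F
  tgt : Arc → F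
  inv : Arc → Arc
  src_inv : ∀ a, src (inv a) = tgt a
  tgt_inv : ∀ a, tgt (inv a) = src a
  gain : Arc → ZMod 2
  gain_inv : ∀ a, gain (inv a) = gain a
  color : Arc → C
  color_inv : ∀ a, color (inv a) = color a

/-! ### Counting color changes along a list -/

section Changes

variable {C : Type*}

open Classical in
/-- The number of color changes in the sequence `c :: l`. -/
noncomputable def changesFrom : C → List C → ℕ
  | _, [] => 0
  | a, b :: l => (if a = b then 0 else 1) + changesFrom b l

/-- The number of color changes in a sequence. -/
noncomputable def numChanges : List C → ℕ
  | [] => 0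
  | a :: l => changesFrom a l

theorem changesFrom_append_cons (a b : C) (l r : List C) :
    changesFrom a (l ++ b :: r) = changesFrom a (l ++ [b]) + changesFrom b r := by
  induction l generalizing a with
  | nil => simp [changesFrom]
  | cons c l ih => simp only [List.cons_append, changesFrom, ih c]; omega

theorem numChanges_append_cons (b : C) (l r : List C) :
    numChanges (l ++ b :: r) = numChanges (l ++ [b]) + changesFrom b r := by
  cases l with
  | nil => simp [numChanges, changesFrom]
  | cons a l => exact changesFrom_append_cons a b l r

/-- Triangle inequality for the discrete metric on colors; it makes the count monotone under
sublists. -/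
theorem changesFrom_le (a b : C) (l : List C) :
    changesFrom a l ≤ changesFrom a [b] + changesFrom b l := by
  cases l with
  | nil => simp [changesFrom]
  | cons c l =>
    simp only [changesFrom]
    split_ifs <;> first | omega | (exfalso; simp_all)

theorem changesFrom_le_of_sublist {l r : List C} (h : l.Sublist r) (a : C) :
    changesFrom a l ≤ changesFrom a r := by
  induction h generalizing a with
  | slnil => exact le_rfl
  | @cons l r b _ ih =>
    have := ih b
    have h2 := changesFrom_le a b l
    simp only [changesFrom] at h2 ⊢
    omega
  | @cons_cons l r b _ ih =>
    have := ih b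
    simp only [changesFrom]
    omega

theorem numChanges_le_cons (a : C) (l : List C) : numChanges l ≤ numChanges (a :: l) := by
  cases l with
  | nil => simp [numChanges]
  | cons b l => simp [numChanges, changesFrom]

theorem numChanges_le_of_sublist {l r : List C} (h : l.Sublist r) :
    numChanges l ≤ numChanges r := by
  induction h with
  | slnil => exact le_rfl
  | @cons l r b _ ih => exact ih.trans (numChanges_le_cons b r)
  | @cons_cons l r b h _ => exact changesFrom_le_of_sublist h b

theorem changesFrom_append_of_forall_eq {c : C} {q : List C} (hq : ∀ x ∈ q, x = c) (r : List C) :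
    changesFrom c (q ++ r) = changesFrom c r := by
  induction q with
  | nil => rfl
  | cons a q ih =>
    obtain rfl : a = c := hq a (by simp)
    simp [changesFrom, ih fun x hx => hq x (by simp [hx])]

/-- A monochromatic chord inserted before an entry of its own color costs no extra change. -/
theorem numChanges_append_append_cons {c : C} {q : List C} (hq : ∀ x ∈ q, x = c) (l r : List C) :
    numChanges (l ++ (q ++ c :: r)) = numChanges (l ++ [c]) + changesFrom c r := by
  cases q with
  | nil => exact numChanges_append_cons c l r
  | cons a q =>
    obtain rfl : a = c := hq a (by simp)
    rw [List.cons_append, numChanges_append_cons,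
      changesFrom_append_of_forall_eq fun x hx => hq x (by simp [hx])]
    simp [changesFrom]

end Changes

/-! ### Cutting a list at chosen entries -/

theorem List.exists_eq_append_getElem_append {α : Type*} (l : List α) {i j : ℕ} (hij : i < j)
    (hj : j < l.length) :
    ∃ A B C : List α, l = A ++ l[i] :: (B ++ l[j] :: C) := by
  refine ⟨l.take i, (l.take j).drop (i + 1), l.drop (j + 1), ?_⟩
  have h1 : l = l.take j ++ l[j] :: l.drop (j + 1) := by simp
  have h2 : l.take j = (l.take j).take i ++ (l.take j)[i]'(by simp; omega) ::
      (l.take j).drop (i + 1) := by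
    rw [← List.drop_eq_getElem_cons, List.take_append_drop]
  conv_lhs => rw [h1, h2]
  simp [List.take_take, min_eq_left hij.le]

theorem List.exists_eq_append_getElem_append_succ {α : Type*} (l : List α) {i j : ℕ} (hij : i < j)
    (hj : j + 1 < l.length) :
    ∃ A B C : List α, l = A ++ l[i] :: (B ++ l[j] :: l[j + 1] :: C) := by
  refine ⟨l.take i, (l.take j).drop (i + 1), l.drop (j + 2), ?_⟩
  have h1 : l = l.take j ++ l[j] :: l[j + 1] :: l.drop (j + 2) := by simp
  have h2 : l.take j = (l.take j).take i ++ (l.take j)[i]'(by simp; omega) ::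
      (l.take j).drop (i + 1) := by
    rw [← List.drop_eq_getElem_cons, List.take_append_drop]
  conv_lhs => rw [h1, h2]
  simp [List.take_take, min_eq_left hij.le]

/-! ### Walks, potentials and the shortening of odd closed walks -/

namespace GainGraph

variable {F : Type*} {C : Type*} (Γ : GainGraph F C)

/-- `l` is the list of arcs of a walk from `f` to `g`. -/
def IsWalk : F → List Γ.Arc → F → Prop
  | f, [], g => f = g
  | f, a :: l, g => Γ.src a = f ∧ IsWalk (Γ.tgt a) l g

/-- The total gain of a list of arcs. -/
def totalGain (l : List Γ.Arc) : ZMod 2 := (l.map Γ.gain).sum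

variable {Γ}

@[simp] theorem isWalk_nil {f g : F} : Γ.IsWalk f [] g ↔ f = g := Iff.rfl

@[simp] theorem isWalk_cons {f g : F} {a : Γ.Arc} {l : List Γ.Arc} :
    Γ.IsWalk f (a :: l) g ↔ Γ.src a = f ∧ Γ.IsWalk (Γ.tgt a) l g := Iff.rfl

@[simp] theorem totalGain_nil : Γ.totalGain [] = 0 := rfl

@[simp] theorem totalGain_cons (a : Γ.Arc) (l : List Γ.Arc) :
    Γ.totalGain (a :: l) = Γ.gain a + Γ.totalGain l := by simp [totalGain]

@[simp] theorem totalGain_append (l r : List Γ.Arc) :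
    Γ.totalGain (l ++ r) = Γ.totalGain l + Γ.totalGain r := by simp [totalGain]

theorem isWalk_append {f g : F} {l r : List Γ.Arc} :
    Γ.IsWalk f (l ++ r) g ↔ ∃ k, Γ.IsWalk f l k ∧ Γ.IsWalk k r g := by
  induction l generalizing f with
  | nil => simp
  | cons a l ih => simp [ih, and_assoc]

theorem IsWalk.append {f g k : F} {l r : List Γ.Arc} (hl : Γ.IsWalk f l k) (hr : Γ.IsWalk k r g) :
    Γ.IsWalk f (l ++ r) g := isWalk_append.2 ⟨k, hl, hr⟩

theorem IsWalk.exists_reverse {f g : F} {l : List Γ.Arc} (hl : Γ.IsWalk f l g) :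
    ∃ r, Γ.IsWalk g r f ∧ Γ.totalGain r = Γ.totalGain l ∧
      ∀ c, (∀ a ∈ l, Γ.color a = c) → ∀ a ∈ r, Γ.color a = c := by
  induction l generalizing f with
  | nil => exact ⟨[], hl.symm, rfl, fun _ _ => by simp⟩
  | cons a l ih =>
    obtain ⟨r, hr, hg, hc⟩ := ih hl.2
    refine ⟨r ++ [Γ.inv a], hr.append ⟨Γ.src_inv a, (Γ.tgt_inv a).trans hl.1⟩, ?_, ?_⟩
    · simp [hg, Γ.gain_inv, add_comm]
    · intro c h b hb
      rcases List.mem_append.1 hb with hb | hb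
      · exact hc c (fun a ha => h a (by simp [ha])) b hb
      · obtain rfl := List.mem_singleton.1 hb
        rw [Γ.color_inv]
        exact h a (by simp)

/-- The potential of a vertex is the gain of a walk to it from a root of its component; balance of
closed walks makes the choice of walk immaterial. -/
theorem exists_potential (h : ∀ f l, Γ.IsWalk f l f → Γ.totalGain l = 0) :
    ∃ p : F → ZMod 2, ∀ a, Γ.gain a = p (Γ.src a) + p (Γ.tgt a) := by
  let R : Setoid F :=
    { r := fun f g => ∃ l, Γ.IsWalk f l g
      iseqv := ⟨fun f => ⟨[], rfl⟩, fun ⟨l, hl⟩ => (hl.exists_reverse).imp fun _ h => h.1,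
        fun ⟨l, hl⟩ ⟨r, hr⟩ => ⟨l ++ r, hl.append hr⟩⟩ }
  have hrep : ∀ f : F, ∃ l, Γ.IsWalk (Quotient.mk R f).out l f := fun f => Quotient.mk_out (s := R) f
  choose W hW using hrep
  refine ⟨fun f => Γ.totalGain (W f), fun a => ?_⟩
  have he : Quotient.mk R (Γ.src a) = Quotient.mk R (Γ.tgt a) :=
    Quotient.sound (s := R) ⟨[a], rfl, rfl⟩
  obtain ⟨r, hr, hg, -⟩ := (hW (Γ.tgt a)).exists_reverse
  rw [← he] at hr
  have h0 := h _ _ ((hW (Γ.src a)).append (r := a :: r) ⟨rfl, hr⟩)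
  simp only [totalGain_append, totalGain_cons, hg] at h0
  beta_reduce
  generalize Γ.totalGain (W (Γ.src a)) = x at h0 ⊢
  generalize Γ.totalGain (W (Γ.tgt a)) = y at h0 ⊢
  generalize Γ.gain a = z at h0 ⊢
  clear hr hg
  revert x y z
  decide

/-- If each color class is connected, then an odd closed walk can be replaced by one that is
a simple cycle in which each color occurs consecutively. -/
theorem exists_wellBehaved_cycle
    (hconn : ∀ a b, Γ.color a = Γ.color b →
      ∃ q, Γ.IsWalk (Γ.src a) q (Γ.src b) ∧ ∀ x ∈ q, Γ.color x = Γ.color a)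
    (f : F) (l : List Γ.Arc) (hl : Γ.IsWalk f l f) (hodd : Γ.totalGain l = 1) :
    ∃ f l, Γ.IsWalk f l f ∧ Γ.totalGain l = 1 ∧ (l.map Γ.src).Nodup ∧
      ∀ i j k (_ : i < j) (_ : j < k) (_ : k < l.length),
        Γ.color l[i] = Γ.color l[k] → Γ.color l[j] = Γ.color l[i] := by
  have parity : ∀ x y z : ZMod 2, x + y + z = 1 → y = 1 ∨ x + z = 1 := by decide
  by_cases hnd : (l.map Γ.src).Nodup
  · by_cases hcons : ∀ i j k (_ : i < j) (_ : j < k) (_ : k < l.length),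
        Γ.color l[i] = Γ.color l[k] → Γ.color l[j] = Γ.color l[i]
    · exact ⟨f, l, hl, hodd, hnd, hcons⟩
    · push Not at hcons
      obtain ⟨i, j, k, hij, hjk, hk, hik, hne⟩ := hcons
      -- Take the first return `n + 1` to the color of `l[i]` after `j`. By minimality `l[n]` has
      -- another color, so a color change sits exactly between `n` and `n + 1`.
      have hex : ∃ n, j ≤ n ∧ ∃ hn : n + 1 < l.length, Γ.color l[n + 1] = Γ.color l[i] := by
        refine ⟨k - 1, by omega, by omega, ?_⟩
        simp only [show k - 1 + 1 = k by omega, hik]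
      classical
      obtain ⟨hjn, hn, hcn⟩ := Nat.find_spec hex
      have hmin := fun n' => Nat.find_min hex (m := n')
      generalize Nat.find hex = n at hjn hn hcn hmin
      have hnc : Γ.color l[n] ≠ Γ.color l[i] := by
        rcases hjn.eq_or_lt with rfl | h
        · exact hne
        · intro h'
          refine hmin (n - 1) (by omega) ⟨by omega, by omega, ?_⟩
          simp only [show n - 1 + 1 = n by omega, h']
      obtain ⟨A, B, D, hABD⟩ :=
        l.exists_eq_append_getElem_append_succ (i := i) (j := n) (by omega) hn
      generalize l[i] = x at *
      generalize l[n] = b at *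
      generalize l[n + 1] = y at *
      obtain ⟨q, hq, hqc⟩ := hconn y x hcn
      obtain ⟨q', hq', hqg, hqc'⟩ := hq.exists_reverse
      replace hqc' := hqc' _ hqc
      rw [hABD] at hl hodd
      obtain ⟨k1, hA, hx, h2⟩ := isWalk_append.1 hl
      obtain ⟨k2, hB, hb, hy, hD⟩ := isWalk_append.1 h2
      subst hx hb
      have hch : numChanges (l.map Γ.color) = numChanges (A.map Γ.color ++ [Γ.color x]) +
          (changesFrom (Γ.color x) (B.map Γ.color ++ [Γ.color b]) +
          (1 + changesFrom (Γ.color x) (D.map Γ.color))) := by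
        rw [hABD, List.map_append, List.map_cons, numChanges_append_cons, List.map_append,
          List.map_cons, changesFrom_append_cons, List.map_cons, changesFrom, if_neg, hcn]
        rwa [hcn]
      -- The chord is used once in each piece, so its gain cancels mod 2 and the two gains sum to
      -- that of `l`. Both pieces drop the change from `b` to `y`.
      have hodd' : Γ.totalGain (q ++ x :: (B ++ [b])) = 1 ∨
          Γ.totalGain (A ++ (q' ++ y :: D)) = 1 := by
        have key : ∀ A q x B b y D : ZMod 2, A + (x + (B + (b + (y + D)))) = 1 →
          q + (x + (B + b)) = 1 ∨ A + (q + (y + D)) = 1 := by decide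
        simp only [totalGain_append, totalGain_cons, hqg, totalGain_nil, add_zero] at hodd ⊢
        exact key _ _ _ _ _ _ _ hodd
      rcases hodd' with h1 | h1
      · have hlt : numChanges ((q ++ x :: (B ++ [b])).map Γ.color) <
            numChanges (l.map Γ.color) := by
          have := numChanges_append_append_cons (c := Γ.color x) (q := q.map Γ.color)
            (by simpa [hcn] using hqc) [] (B.map Γ.color ++ [Γ.color b])
          rw [List.nil_append, List.nil_append,
            show numChanges [Γ.color x] = 0 from rfl, zero_add] at this
          simp only [List.map_append, List.map_cons, List.map_nil]
          omega
        exact exists_wellBehaved_cycle hconn (Γ.src y) (q ++ x :: (B ++ [b]))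
          (hq.append ⟨rfl, hB.append ⟨rfl, hy.symm⟩⟩) h1
      · have hlt : numChanges ((A ++ (q' ++ y :: D)).map Γ.color) <
            numChanges (l.map Γ.color) := by
          have := numChanges_append_append_cons (c := Γ.color x) (q := q'.map Γ.color)
            (by simpa [hcn] using hqc') (A.map Γ.color) (D.map Γ.color)
          simp only [List.map_append, List.map_cons, hcn]
          omega
        exact exists_wellBehaved_cycle hconn f (A ++ (q' ++ y :: D))
          (hA.append (hq'.append ⟨rfl, hD⟩)) h1
  · obtain ⟨i, j, hij, hj, he⟩ : ∃ i j, ∃ (hij : i < j) (hj : j < l.length),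
        Γ.src l[i] = Γ.src l[j] := by
      simp only [List.Nodup, List.pairwise_iff_getElem, List.length_map, List.getElem_map] at hnd
      push Not at hnd
      obtain ⟨i, j, _, hj, hij, he⟩ := hnd
      exact ⟨i, j, hij, hj, he⟩
    obtain ⟨A, B, D, hABD⟩ := l.exists_eq_append_getElem_append hij hj
    generalize l[i] = x at *
    generalize l[j] = y at *
    have hABD' : l = A ++ ((x :: B) ++ y :: D) := hABD
    rw [hABD'] at hl hodd
    obtain ⟨k1, hA, h2⟩ := isWalk_append.1 hl
    obtain ⟨k2, hxB, hyD⟩ := isWalk_append.1 h2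
    have hx := hxB.1
    have hy := hyD.1
    rw [totalGain_append, totalGain_append, ← add_assoc] at hodd
    rcases parity _ _ _ hodd with h1 | h1
    · have hs : (x :: B).Sublist l := by
        rw [hABD']
        exact (List.sublist_append_left _ _).trans (List.sublist_append_right _ _)
      have hle := numChanges_le_of_sublist (hs.map Γ.color)
      have hlen : (x :: B).length < l.length := by rw [hABD']; simp; omega
      refine exists_wellBehaved_cycle hconn k1 (x :: B) ?_ h1
      rwa [← hy, ← he, hx] at hxB
    · have hs : (A ++ y :: D).Sublist l := by
        rw [hABD']
        exact (List.Sublist.refl _).append (List.sublist_append_right _ _)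
      have hle := numChanges_le_of_sublist (hs.map Γ.color)
      have hlen : (A ++ y :: D).length < l.length := by rw [hABD']; simp
      refine exists_wellBehaved_cycle hconn f (A ++ y :: D) (hA.append ?_)
        (by rwa [totalGain_append])
      rwa [← hx, he, hy]
-- A chord may lengthen the walk but removes a color change; a split at a repeated vertex adds no
-- change and shortens the walk.
termination_by (numChanges (l.map Γ.color), l.length)
decreasing_by
  · exact Prod.Lex.left _ _ hlt
  · exact Prod.Lex.left _ _ hlt
  · exact Prod.lex_def.2 (hle.lt_or_eq.imp_right fun h => ⟨h, hlen⟩)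
  · exact Prod.lex_def.2 (hle.lt_or_eq.imp_right fun h => ⟨h, hlen⟩)

end GainGraph

/-! ### Homology of the sphere mod 2 -/

namespace PlaneEmbedding

open Matrix

variable {V F : Type*} {G : SimpleGraph V}

/-- The edge underlying a dart. -/
def _root_.SimpleGraph.Dart.toEdge (d : G.Dart) : G.edgeSet := ⟨d.edge, d.edge_mem⟩

theorem _root_.SimpleGraph.Dart.toEdge_surjective (e : G.edgeSet) :
    ∃ d : G.Dart, d.toEdge = e := by
  obtain ⟨e, he⟩ := e
  induction e with
  | _ a b => exact ⟨⟨(a, b), he⟩, rfl⟩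

theorem _root_.SimpleGraph.Dart.toEdge_symm (d : G.Dart) : d.symm.toEdge = d.toEdge :=
  Subtype.ext d.edge_symm

open Classical in
theorem _root_.SimpleGraph.Dart.sum_toEdge_eq [Fintype G.Dart] (d : G.Dart) (g : G.Dart → ZMod 2) :
    (∑ d' : G.Dart, if d'.toEdge = d.toEdge then g d' else 0) = g d + g d.symm := by
  rw [← Finset.sum_filter,
    show Finset.univ.filter (fun d' : G.Dart => d'.toEdge = d.toEdge) = {d, d.symm} by
      ext d'
      simp [SimpleGraph.Dart.toEdge, SimpleGraph.dart_edge_eq_iff],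
    Finset.sum_pair d.symm_ne.symm]

open Classical in
/-- The incidence matrix between edges and vertices, with coefficients in `ZMod 2`. -/
noncomputable def edgeVertex (G : SimpleGraph V) [Fintype G.Dart] :
    Matrix G.edgeSet V (ZMod 2) :=
  fun e v => ∑ d : G.Dart, if d.toEdge = e ∧ d.fst = v then 1 else 0

open Classical in
/-- The incidence matrix between faces and edges, with coefficients in `ZMod 2`. -/
noncomputable def faceEdge (P : PlaneEmbedding G F) [Fintype G.Dart] :
    Matrix F G.edgeSet (ZMod 2) :=
  fun f e => ∑ d : G.Dart, if P.left d = f ∧ d.toEdge = e then 1 else 0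

variable (P : PlaneEmbedding G F) [Fintype G.Dart]

theorem edgeVertex_mulVec [Fintype V] (h : V → ZMod 2) (d : G.Dart) :
    (edgeVertex G *ᵥ h) d.toEdge = h d.fst + h d.snd := by
  classical
  have := d.sum_toEdge_eq fun d => h d.fst
  rw [← show d.symm.fst = d.snd from rfl, ← this]
  simp only [mulVec, dotProduct, edgeVertex, Finset.sum_mul]
  rw [Finset.sum_comm]
  refine Finset.sum_congr rfl fun d' _ => ?_
  simp [ite_and]

open Classical in
theorem faceEdge_mulVec [Fintype G.edgeSet] (x : G.edgeSet → ZMod 2) (f : F) :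
    (P.faceEdge *ᵥ x) f = ∑ d : G.Dart, if P.left d = f then x d.toEdge else 0 := by
  simp only [mulVec, dotProduct, faceEdge, Finset.sum_mul]
  rw [Finset.sum_comm]
  refine Finset.sum_congr rfl fun d' _ => ?_
  simp [ite_and]

theorem faceEdge_transpose_mulVec [Fintype F] (p : F → ZMod 2) (d : G.Dart) :
    (P.faceEdgeᵀ *ᵥ p) d.toEdge = p (P.left d) + p (P.left d.symm) := by
  classical
  have := d.sum_toEdge_eq fun d => p (P.left d)
  rw [← this]
  simp only [mulVec, dotProduct, faceEdge, Finset.sum_mul, transpose_apply]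
  rw [Finset.sum_comm]
  refine Finset.sum_congr rfl fun d' _ => ?_
  simp [ite_and]

/-- Tracing face boundaries permutes the darts with a given face on the left, and takes the target
of each to the source of the next. Hence sources and targets contribute equal sums, which cancel. -/
theorem faceEdge_mulVec_edgeVertex_mulVec [Fintype V] [Fintype G.edgeSet] (h : V → ZMod 2) :
    P.faceEdge *ᵥ (edgeVertex G *ᵥ h) = 0 := by
  classical
  ext f
  rw [faceEdge_mulVec]
  simp only [edgeVertex_mulVec]
  let φ : Equiv.Perm G.Dart :=
    (Function.Involutive.toPerm _ (SimpleGraph.Dart.symm_involutive (G := G))).trans P.rot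
  have hφ : ∀ d, (φ d).fst = d.snd := fun d => P.rot_fst d.symm
  have hl : ∀ d, P.left (φ d) = P.left d := P.left_rot_symm
  have key : (∑ d : G.Dart, if P.left d = f then h d.snd else 0) =
      ∑ d : G.Dart, if P.left d = f then h d.fst else 0 := by
    rw [← Equiv.sum_comp φ fun d => if P.left d = f then h d.fst else 0]
    simp only [hφ, hl]
  have : ∀ d : G.Dart, (if P.left d = f then h d.fst + h d.snd else 0) =
      (if P.left d = f then h d.fst else 0) + if P.left d = f then h d.snd else 0 := by
    intro d
    split_ifs <;> simp
  simp only [this, Finset.sum_add_distrib, key, CharTwo.add_self_eq_zero, Pi.zero_apply]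

/-- A function with zero coboundary is constant on connected components. -/
theorem finrank_ker_edgeVertex_le [Fintype V] :
    Module.finrank (ZMod 2) (LinearMap.ker (edgeVertex G).mulVecLin) ≤
      Nat.card G.ConnectedComponent := by
  classical
  have : Fintype G.ConnectedComponent := Fintype.ofFinite _
  let L := LinearMap.funLeft (ZMod 2) (ZMod 2) G.connectedComponentMk
  have hle : LinearMap.ker (edgeVertex G).mulVecLin ≤ LinearMap.range L := by
    intro h hh
    have hh : edgeVertex G *ᵥ h = 0 := hh
    have hadj : ∀ u v, G.Adj u v → h u = h v := fun u v huv =>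
      CharTwo.add_eq_zero.1 ((edgeVertex_mulVec h ⟨(u, v), huv⟩).symm.trans (by rw [hh]; rfl))
    have hr : ∀ u v, G.Reachable u v → h u = h v := by
      rintro u v ⟨p⟩
      induction p with
      | nil => rfl
      | cons h1 _ ih => exact (hadj _ _ h1).trans ih
    refine ⟨fun c => h c.out, funext fun v => hr _ _ ?_⟩
    exact SimpleGraph.ConnectedComponent.exact (Quot.out_eq _)
  calc _ ≤ Module.finrank (ZMod 2) (LinearMap.range L) := Submodule.finrank_mono hle
    _ ≤ Module.finrank (ZMod 2) (G.ConnectedComponent → ZMod 2) := LinearMap.finrank_range_le L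
    _ = _ := by simp

/-- A face function with no jump across any edge is constant, as the dual is connected. -/
theorem finrank_ker_faceEdge_transpose_le [Fintype F] :
    Module.finrank (ZMod 2) (LinearMap.ker (P.faceEdgeᵀ).mulVecLin) ≤ 1 := by
  let L : ZMod 2 →ₗ[ZMod 2] (F → ZMod 2) := LinearMap.pi fun _ => LinearMap.id
  have hle : LinearMap.ker (P.faceEdgeᵀ).mulVecLin ≤ LinearMap.range L := by
    intro p hp
    have hp : P.faceEdgeᵀ *ᵥ p = 0 := hp
    have hconst : ∀ f g, p f = p g := fun f g => by
      induction P.faces_connected f g with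
      | refl => rfl
      | tail _ h ih =>
        obtain ⟨d, rfl, rfl⟩ := h
        exact ih.trans (CharTwo.add_eq_zero.1
          ((P.faceEdge_transpose_mulVec p d).symm.trans (by rw [hp]; rfl)))
    rcases isEmpty_or_nonempty F with hF | ⟨⟨f⟩⟩
    · exact ⟨0, funext fun f => hF.elim f⟩
    · exact ⟨p f, funext fun g => hconst f g⟩
  calc _ ≤ Module.finrank (ZMod 2) (LinearMap.range L) := Submodule.finrank_mono hle
    _ ≤ Module.finrank (ZMod 2) (ZMod 2) := LinearMap.finrank_range_le L
    _ = _ := by simp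

/-- A set of edges meeting every face boundary evenly is a cut (the first cohomology of the
sphere vanishes). -/
theorem exists_edgeVertex_mulVec_eq [Fintype V] [Fintype F] [Fintype G.edgeSet]
    (x : G.edgeSet → ZMod 2) (hx : P.faceEdge *ᵥ x = 0) :
    ∃ h : V → ZMod 2, edgeVertex G *ᵥ h = x := by
  have hle : LinearMap.range (edgeVertex G).mulVecLin ≤ LinearMap.ker P.faceEdge.mulVecLin := by
    rintro _ ⟨h, rfl⟩
    exact P.faceEdge_mulVec_edgeVertex_mulVec h
  have h1 := (edgeVertex G).mulVecLin.finrank_range_add_finrank_ker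
  have h2 := P.faceEdge.mulVecLin.finrank_range_add_finrank_ker
  have h3 := (P.faceEdgeᵀ).mulVecLin.finrank_range_add_finrank_ker
  have h4 : Module.finrank (ZMod 2) (LinearMap.range (P.faceEdgeᵀ).mulVecLin) =
      Module.finrank (ZMod 2) (LinearMap.range P.faceEdge.mulVecLin) :=
    Matrix.rank_transpose P.faceEdge
  have h5 := finrank_ker_edgeVertex_le (G := G)
  have h6 := P.finrank_ker_faceEdge_transpose_le
  have h7 := P.euler
  simp only [Module.finrank_fintype_fun_eq_card, ← Nat.card_eq_fintype_card] at h1 h2 h3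
  -- With `c` components, the range has dimension at least `|V| - c` and the kernel at most `|E| -
  -- |F| + 1`, because a matrix and its transpose have equal rank. Euler's formula equates the two
  -- bounds.
  have heq := Submodule.eq_of_le_of_finrank_le hle (by omega)
  exact (heq ▸ (show x ∈ LinearMap.ker P.faceEdge.mulVecLin from hx) :
    x ∈ LinearMap.range (edgeVertex G).mulVecLin)

/-- Sum the edges of a walk from `s` to `t`; the coboundary telescopes along it. -/
theorem exists_dotProduct_edgeVertex_mulVec [Fintype V] [Fintype G.edgeSet] {s t : V}
    (hst : G.Reachable s t) :
    ∃ w : G.edgeSet → ZMod 2, ∀ h : V → ZMod 2, w ⬝ᵥ (edgeVertex G *ᵥ h) = h s + h t := by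
  classical
  obtain ⟨p⟩ := hst
  induction p with
  | nil => exact ⟨0, fun h => by simp [CharTwo.add_self_eq_zero]⟩
  | @cons u v t huv _ ih =>
    obtain ⟨w, hw⟩ := ih
    let d : G.Dart := ⟨(u, v), huv⟩
    refine ⟨Pi.single d.toEdge 1 + w, fun h => ?_⟩
    rw [add_dotProduct, hw, single_one_dotProduct, edgeVertex_mulVec]
    have key : ∀ a b c : ZMod 2, a + b + (b + c) = a + c := by decide
    exact key _ _ _

end PlaneEmbedding

/-! ### Colored dual walks and separation -/

namespace PlaneEmbedding

open Matrix

variable {V F : Type*} {G : SimpleGraph V} (P : PlaneEmbedding G F) {m : ℕ}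

/-- The dual graph whose arcs are the darts of `G` colored by one of the colors in `S` of the
underlying edge. -/
def coloredDual (σ : V → Set (Fin m)) (S : Set (Fin m)) (w : G.edgeSet → ZMod 2) :
    GainGraph F S where
  Arc := {a : G.Dart × S // (a.2 : Fin m) ∈ edgeColors σ a.1.edge}
  src a := P.left a.1.1
  tgt a := P.left a.1.1.symm
  inv a := ⟨(a.1.1.symm, a.1.2), by rw [SimpleGraph.Dart.edge_symm]; exact a.2⟩
  src_inv _ := rfl
  tgt_inv a := by rw [SimpleGraph.Dart.symm_symm]
  gain a := w a.1.1.toEdge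
  gain_inv a := by rw [SimpleGraph.Dart.toEdge_symm]
  color a := a.1.2
  color_inv _ := rfl

variable {σ : V → Set (Fin m)} {S : Set (Fin m)} {w : G.edgeSet → ZMod 2}

theorem mem_edgeColors_dart {c : Fin m} {d : G.Dart} :
    c ∈ edgeColors σ d.edge ↔ c ∈ σ d.fst ∨ c ∈ σ d.snd := by
  change (∃ v ∈ s(d.fst, d.snd), c ∈ σ v) ↔ _
  simp

theorem left_rot (d : G.Dart) : P.left (P.rot d) = P.left d.symm := by
  simpa using P.left_rot_symm d.symm

/-- Two faces are joined by a walk in the dual graph all of whose edges have color `c`. -/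
def Joined (P : PlaneEmbedding G F) (σ : V → Set (Fin m)) (S : Set (Fin m))
    (w : G.edgeSet → ZMod 2) (c : S) (f g : F) : Prop :=
  ∃ q, (P.coloredDual σ S w).IsWalk f q g ∧ ∀ x ∈ q, (P.coloredDual σ S w).color x = c

variable {P}

theorem Joined.trans {c : S} {f g k : F} (h : P.Joined σ S w c f g) (h' : P.Joined σ S w c g k) :
    P.Joined σ S w c f k := by
  obtain ⟨q, hq, hc⟩ := h
  obtain ⟨q', hq', hc'⟩ := h'
  refine ⟨q ++ q', hq.append hq', fun x hx => ?_⟩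
  rcases List.mem_append.1 hx with hx | hx
  exacts [hc x hx, hc' x hx]

theorem Joined.symm {c : S} {f g : F} (h : P.Joined σ S w c f g) : P.Joined σ S w c g f := by
  obtain ⟨q, hq, hc⟩ := h
  obtain ⟨r, hr, -, h⟩ := hq.exists_reverse
  exact ⟨r, hr, h c hc⟩

theorem joined_dart {c : S} {d : G.Dart} (h : (c : Fin m) ∈ edgeColors σ d.edge) :
    P.Joined σ S w c (P.left d) (P.left d.symm) :=
  ⟨[⟨(d, c), h⟩], ⟨rfl, rfl⟩, fun x hx => by rw [List.mem_singleton.1 hx]; rfl⟩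

/-- Turning around a vertex of color `c` crosses only edges incident to it, all of which carry `c`.
-/
theorem joined_of_fst_eq [Finite V] {c : S} {d d' : G.Dart} (h : d.fst = d'.fst)
    (hc : (c : Fin m) ∈ σ d.fst) : P.Joined σ S w c (P.left d) (P.left d') := by
  have : Finite G.Dart := Finite.of_injective _ SimpleGraph.Dart.toProd_injective
  obtain ⟨n, rfl⟩ := (P.rot_sameCycle d d' h).exists_nat_pow_eq
  clear h
  induction n with
  | zero => exact ⟨[], rfl, by simp⟩
  | succ n ih =>
    have hfst : ∀ n, ((P.rot ^ n) d).fst = d.fst := fun n => by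
      induction n with
      | zero => rfl
      | succ n ih => rw [pow_succ', Equiv.Perm.mul_apply, P.rot_fst, ih]
    rw [pow_succ', Equiv.Perm.mul_apply, left_rot]
    exact ih.trans (joined_dart (mem_edgeColors_dart.2 (Or.inl (by rwa [hfst]))))

/-- Follow a path inside the color class: turn around each vertex to reach the next edge, then cross
that edge. -/
theorem joined_of_mem_fst [Finite V] (hσ : ColorConnected G σ) {c : S} {d d' : G.Dart}
    (hd : (c : Fin m) ∈ σ d.fst) (hd' : (c : Fin m) ∈ σ d'.fst) :
    P.Joined σ S w c (P.left d) (P.left d') := by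
  obtain ⟨p⟩ := hσ c ⟨d.fst, hd⟩ ⟨d'.fst, hd'⟩
  generalize hu : (⟨d.fst, hd⟩ : {v | (c : Fin m) ∈ σ v}) = u at p
  generalize hv : (⟨d'.fst, hd'⟩ : {v | (c : Fin m) ∈ σ v}) = v at p
  induction p generalizing d with
  | nil => exact joined_of_fst_eq (congrArg Subtype.val (hu.trans hv.symm)) hd
  | @cons u v' _ huv _ ih =>
    let e : G.Dart := ⟨((u : V), (v' : V)), huv⟩
    have he : d.fst = e.fst := congrArg Subtype.val hu
    refine (joined_of_fst_eq he hd).trans ((joined_dart (d := e) ?_).trans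
      (ih (d := e.symm) v'.2 rfl hv))
    exact mem_edgeColors_dart.2 (Or.inl u.2)

theorem joined_of_mem_edgeColors [Finite V] (hσ : ColorConnected G σ) {c : S} {d d' : G.Dart}
    (hd : (c : Fin m) ∈ edgeColors σ d.edge) (hd' : (c : Fin m) ∈ edgeColors σ d'.edge) :
    P.Joined σ S w c (P.left d) (P.left d') := by
  rcases mem_edgeColors_dart.1 hd with h | h <;> rcases mem_edgeColors_dart.1 hd' with h' | h'
  · exact joined_of_mem_fst hσ h h'
  · exact (joined_of_mem_fst hσ h (d' := d'.symm) h').trans (joined_dart hd').symm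
  · exact (joined_dart hd).trans (joined_of_mem_fst hσ (d := d.symm) h h')
  · exact (joined_dart hd).trans
      ((joined_of_mem_fst hσ (d := d.symm) h (d' := d'.symm) h').trans (joined_dart hd').symm)

theorem exists_odd_closed_walk [Fintype V] [Fintype F] [Fintype G.Dart] [Fintype G.edgeSet]
    {s t : V} (hw : ∀ h : V → ZMod 2, w ⬝ᵥ (edgeVertex G *ᵥ h) = h s + h t)
    (hS : IsColorSeparator G σ s t S) :
    ∃ f l, (P.coloredDual σ S w).IsWalk f l f ∧ (P.coloredDual σ S w).totalGain l = 1 := by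
  classical
  by_contra hcon
  obtain ⟨p, hp⟩ := (P.coloredDual σ S w).exists_potential fun f l hl => by
    by_contra h
    have two : ∀ x : ZMod 2, x ≠ 0 → x = 1 := by decide
    exact hcon ⟨f, l, hl, two _ h⟩
  obtain ⟨hs, ht, hnr⟩ := hS
  let A : Set V := {v | ∃ hv : v ∈ (hostSet σ S)ᶜ,
    (G.induce (hostSet σ S)ᶜ).Reachable ⟨s, hs⟩ ⟨v, hv⟩}
  let h : V → ZMod 2 := fun v => if v ∈ A then 1 else 0
  have hsA : s ∈ A := ⟨hs, SimpleGraph.Reachable.refl _⟩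
  have htA : t ∉ A := fun ⟨_, hr⟩ => hnr hr
  have hA : ∀ u v, G.Adj u v → u ∈ A → v ∈ A ∨ ∃ c ∈ S, c ∈ σ v := by
    rintro u v huv ⟨hu, hr⟩
    by_cases hv : v ∈ hostSet σ S
    · obtain ⟨c, hc, hcS⟩ := hv
      exact Or.inr ⟨c, hcS, hc⟩
    · exact Or.inl ⟨hv, hr.trans (SimpleGraph.Adj.reachable (G := G.induce (hostSet σ S)ᶜ)
        (u := ⟨u, hu⟩) (v := ⟨v, hv⟩) huv)⟩
  -- An edge leaving the component `A` of `s` must end in `hostSet σ S`, so it has an arc in the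
  -- colored dual, where the potential computes `w`.
  have hcut : ∀ d : G.Dart, h d.fst + h d.snd ≠ 0 →
      w d.toEdge = p (P.left d) + p (P.left d.symm) := by
    intro d hd
    have : ∃ c ∈ S, c ∈ edgeColors σ d.edge := by
      by_cases h1 : d.fst ∈ A <;> by_cases h2 : d.snd ∈ A
      · simp [h, h1, h2, CharTwo.add_self_eq_zero] at hd
      · obtain ⟨c, hc, hcs⟩ := (hA _ _ d.adj h1).resolve_left h2
        exact ⟨c, hc, mem_edgeColors_dart.2 (Or.inr hcs)⟩
      · obtain ⟨c, hc, hcs⟩ := (hA _ _ d.adj.symm h2).resolve_left h1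
        exact ⟨c, hc, mem_edgeColors_dart.2 (Or.inl hcs)⟩
      · simp [h, h1, h2] at hd
    obtain ⟨c, hc, hcd⟩ := this
    exact hp ⟨(d, ⟨c, hc⟩), hcd⟩
  have h0 : w ⬝ᵥ (edgeVertex G *ᵥ h) = (P.faceEdgeᵀ *ᵥ p) ⬝ᵥ (edgeVertex G *ᵥ h) := by
    refine Finset.sum_congr rfl fun e _ => ?_
    obtain ⟨d, rfl⟩ := SimpleGraph.Dart.toEdge_surjective e
    rw [edgeVertex_mulVec, faceEdge_transpose_mulVec]
    by_cases hd : h d.fst + h d.snd = 0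
    · simp [hd]
    · rw [hcut d hd]
  rw [mulVec_transpose, ← dotProduct_mulVec, faceEdge_mulVec_edgeVertex_mulVec, hw,
    dotProduct_zero] at h0
  simp [h, hsA, htA] at h0

theorem not_reachable_of_odd_closed_walk [Fintype V] [Fintype F] [Fintype G.Dart]
    [Fintype G.edgeSet] {s t : V}
    (hw : ∀ h : V → ZMod 2, w ⬝ᵥ (edgeVertex G *ᵥ h) = h s + h t) {f : F}
    {l : List (P.coloredDual σ S w).Arc} (hl : (P.coloredDual σ S w).IsWalk f l f)
    (hodd : (P.coloredDual σ S w).totalGain l = 1) (D : Set (Sym2 V))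
    (hD : ∀ a ∈ l, a.1.1.edge ∈ D) : ¬ (G.deleteEdges D).Reachable s t := by
  classical
  -- Edge vector mod 2 of the walk; its boundary is the sum of the two end faces, hence zero for a
  -- closed walk.
  let x : List (P.coloredDual σ S w).Arc → G.edgeSet → ZMod 2 := fun l =>
    (l.map fun a => Pi.single a.1.1.toEdge 1).sum
  have hself : ∀ p : F → ZMod 2, p + p = 0 := fun p => funext fun _ => CharTwo.add_self_eq_zero _
  have hface : ∀ (l : List (P.coloredDual σ S w).Arc) (f g : F),
      (P.coloredDual σ S w).IsWalk f l g → P.faceEdge *ᵥ x l = Pi.single f 1 + Pi.single g 1 := by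
    intro l
    induction l with
    | nil =>
      rintro f _ rfl
      simp [x, hself]
    | cons a l ih =>
      rintro f g ⟨rfl, hl⟩
      have hx : x (a :: l) = Pi.single a.1.1.toEdge 1 + x l := by simp [x]
      have ha : P.faceEdge *ᵥ Pi.single a.1.1.toEdge 1 =
          Pi.single (P.left a.1.1) 1 + Pi.single (P.left a.1.1.symm) 1 := by
        ext f
        have h1 := a.1.1.sum_toEdge_eq fun d => if P.left d = f then 1 else 0
        simp only [faceEdge_mulVec, Pi.single_apply, Pi.add_apply, eq_comm (a := f)]
        rw [← h1]
        refine Finset.sum_congr rfl fun d _ => ?_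
        split_ifs <;> rfl
      rw [hx, mulVec_add, ih _ _ hl, ha]
      have key : ∀ a b c : F → ZMod 2, a + b + (b + c) = a + c := fun a b c => by
        rw [add_assoc, ← add_assoc b, hself, zero_add]
      exact key _ _ _
  have hdot : ∀ l : List (P.coloredDual σ S w).Arc,
      w ⬝ᵥ x l = (P.coloredDual σ S w).totalGain l := by
    intro l
    induction l with
    | nil => simp [x]
    | cons a l ih =>
      have hx : x (a :: l) = Pi.single a.1.1.toEdge 1 + x l := by simp [x]
      rw [hx, dotProduct_add, ih, dotProduct_single_one, GainGraph.totalGain_cons]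
      rfl
  have hsupp : ∀ (l : List (P.coloredDual σ S w).Arc) (d : G.Dart),
      (∀ a ∈ l, a.1.1.edge ≠ d.edge) → x l d.toEdge = 0 := by
    intro l d
    induction l with
    | nil => simp [x]
    | cons a l ih =>
      intro h
      have hx : x (a :: l) = Pi.single a.1.1.toEdge 1 + x l := by simp [x]
      rw [hx, Pi.add_apply, ih fun b hb => h b (by simp [hb]), Pi.single_eq_of_ne, zero_add]
      exact fun he => h a (by simp) (congrArg Subtype.val he).symm
  obtain ⟨h, hh⟩ := P.exists_edgeVertex_mulVec_eq (x l)
    (by rw [hface l f f hl, hself])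
  have hst : h s + h t = 1 := by rw [← hw, hh, hdot, hodd]
  rintro ⟨p⟩
  have hconst : h s = h t := by
    clear hst hw
    induction p with
    | nil => rfl
    | @cons u v _ huv _ ih =>
      rw [SimpleGraph.deleteEdges_adj] at huv
      refine Eq.trans (CharTwo.add_eq_zero.1 ?_) ih
      let d : G.Dart := ⟨(u, v), huv.1⟩
      rw [show h u + h v = h d.fst + h d.snd from rfl, ← edgeVertex_mulVec, hh]
      exact hsupp l d fun a ha he => huv.2 (he.subst (motive := (· ∈ D)) (hD a ha))
  rw [hconst, CharTwo.add_self_eq_zero] at hst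
  exact zero_ne_one hst

end PlaneEmbedding

/-! ### From linear to cyclic consecutiveness -/

theorem Fin.val_sub_lt_iff {k : ℕ} {a i : Fin (k + 1)} {n : ℕ} (hn : a + n ≤ k + 1) :
    ((i - a : Fin (k + 1)) : ℕ) < n ↔ (a : ℕ) ≤ i ∧ (i : ℕ) < a + n := by
  have ha := a.isLt
  have hi := i.isLt
  rcases le_or_gt a i with h | h
  · rw [Fin.sub_val_of_le h]
    have : (a : ℕ) ≤ i := h
    omega
  · have h' : (i : ℕ) < a := h
    rw [Fin.coe_sub_iff_lt.2 h]
    omega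

theorem wellBehaved_of_consecutive {C : Type*} {k : ℕ} (Z : Fin (k + 1) → C)
    (hZ : ∀ i j l, i < j → j < l → Z i = Z l → Z j = Z i) : WellBehaved Z := by
  classical
  intro c
  by_cases hc : ∃ i, Z i = c
  · let T := Finset.univ.filter fun i => Z i = c
    have hT : T.Nonempty := by simpa [T, Finset.filter_nonempty_iff] using hc
    have hmem : ∀ i, i ∈ T ↔ Z i = c := by simp [T]
    have h1 := (hmem _).1 (T.min'_mem hT)
    have h2 := (hmem _).1 (T.max'_mem hT)
    have h3 : T.min' hT ≤ T.max' hT := T.min'_le _ (T.max'_mem hT)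
    -- The occurrences fill the interval from the first to the last, so no wrap-around is needed.
    refine ⟨T.min' hT, T.max' hT + 1 - T.min' hT, fun i => ?_⟩
    have h3' : (T.min' hT : ℕ) ≤ T.max' hT := h3
    rw [Fin.val_sub_lt_iff (by omega)]
    constructor
    · intro hi
      have h4 : (T.min' hT : ℕ) ≤ i := T.min'_le i ((hmem i).2 hi)
      have h5 : (i : ℕ) ≤ T.max' hT := T.le_max' i ((hmem i).2 hi)
      omega
    · rintro ⟨h4, h5⟩
      have h4 : T.min' hT ≤ i := h4
      have h5 : i ≤ T.max' hT := by rw [Fin.le_def]; omega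
      rcases h4.eq_or_lt with h | h
      · rw [← h, h1]
      rcases h5.eq_or_lt with h' | h'
      · rw [h', h2]
      · exact (hZ _ _ _ h h' (h1.trans h2.symm)).trans h1
  · exact ⟨0, 0, fun i => by simpa using fun h => hc ⟨i, h⟩⟩

/-! ### Cyclic indexing of closed walks -/

namespace GainGraph

variable {F C : Type*} {Γ : GainGraph F C}

theorem IsWalk.tgt_getElem {f g : F} {l : List Γ.Arc} (h : Γ.IsWalk f l g) {i : ℕ}
    (hi : i + 1 < l.length) : Γ.tgt l[i] = Γ.src l[i + 1] := by
  induction l generalizing f i with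
  | nil => simp at hi
  | cons a l ih =>
    cases i with
    | succ i => exact ih h.2 (by simpa using hi)
    | zero =>
      cases l with
      | nil => simp at hi
      | cons b l => exact h.2.1.symm

theorem IsWalk.tgt_getElem_last {f g : F} {l : List Γ.Arc} (h : Γ.IsWalk f l g) {n : ℕ}
    (hn : l.length = n + 1) : Γ.tgt l[n] = g := by
  induction l generalizing f n with
  | nil => simp at hn
  | cons a l ih =>
    cases n with
    | succ n => exact ih h.2 (by simpa using hn)
    | zero =>
      obtain rfl : l = [] := by simpa using hn
      exact h.2

theorem IsWalk.tgt_get_eq_src {f : F} {l : List Γ.Arc} (h : Γ.IsWalk f l f) {n : ℕ}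
    (hn : l.length = n + 1) (i : Fin (n + 1)) :
    Γ.tgt (l[(i - 1 : Fin (n + 1))]'(by omega)) = Γ.src (l[i]'(by omega)) := by
  rcases Fin.eq_zero_or_eq_succ i with rfl | ⟨j, rfl⟩
  · have h0 : ((0 - 1 : Fin (n + 1)) : ℕ) = n := by simp
    have h1 := h.tgt_getElem_last hn
    simp only [Fin.getElem_fin, h0, h1]
    cases l with
    | nil => simp at hn
    | cons a l => exact h.1.symm
  · have h0 : ((j.succ - 1 : Fin (n + 1)) : ℕ) = j := by
      rw [← Fin.coeSucc_eq_succ, add_sub_cancel_right, Fin.val_castSucc]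
    simp only [Fin.getElem_fin, h0]
    exact h.tgt_getElem (by omega)

end GainGraph

/-! ### Assembling the cycle and its labels -/

theorem lemma4 {V : Type*} [Finite V] {F : Type*} [Finite F] (G : SimpleGraph V)
    (P : PlaneEmbedding G F) {m : ℕ} (σ : V → Set (Fin m)) (hσ : ColorConnected G σ)
    (s t : V) (hst : G.Reachable s t)
    (S : Set (Fin m)) (hS : IsColorSeparator G σ s t S) :
    ∃ (γ : DualCycle P.dual) (lam : F → S),
      Separates γ s t ∧ IsLabeling σ S γ lam ∧ WellBehaved (fun i => lam (γ.vert i)) := by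
  classical
  have : Finite G.Dart := Finite.of_injective _ SimpleGraph.Dart.toProd_injective
  have := Fintype.ofFinite V
  have := Fintype.ofFinite F
  have := Fintype.ofFinite G.Dart
  have := Fintype.ofFinite G.edgeSet
  obtain ⟨w, hw⟩ := PlaneEmbedding.exists_dotProduct_edgeVertex_mulVec hst
  obtain ⟨f, l, hl, hodd⟩ := PlaneEmbedding.exists_odd_closed_walk (P := P) hw hS
  obtain ⟨f, l, hl, hodd, hnd, hcons⟩ := GainGraph.exists_wellBehaved_cycle
    (fun a b hab => PlaneEmbedding.joined_of_mem_edgeColors hσ a.2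
      ((show a.1.2 = b.1.2 from hab).symm.subst (motive := fun c : S => (c : Fin m) ∈
        edgeColors σ b.1.1.edge) b.2)) f l hl hodd
  obtain ⟨k, hk⟩ : ∃ k, l.length = k + 1 := by
    refine Nat.exists_eq_succ_of_ne_zero fun h => ?_
    rw [List.length_eq_zero_iff.1 h] at hodd
    exact zero_ne_one hodd
  let arc : Fin (k + 1) → (P.coloredDual σ S w).Arc := fun i => l[i]
  have hmem : ∀ a ∈ l, ∃ i, arc i = a := fun a ha => by
    obtain ⟨i, hi, rfl⟩ := List.getElem_of_mem ha
    exact ⟨⟨i, by omega⟩, rfl⟩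
  have hlink : ∀ i, P.left (arc (i - 1)).1.1.symm = P.left (arc i).1.1 :=
    hl.tgt_get_eq_src hk
  have hsrc : Function.Injective fun i => P.left (arc i).1.1 := by
    intro i j hij
    have := (List.nodup_iff_injective_getElem.1 hnd)
      (a₁ := ⟨i, by simp; omega⟩) (a₂ := ⟨j, by simp; omega⟩) (by
        simp only [List.getElem_map]
        exact hij)
    exact Fin.ext (by simpa using this)
  have hvert : Function.Injective fun i => P.left (arc i).1.1.symm := by
    intro i j hij
    have h := @hsrc (i + 1) (j + 1) (by simpa [← hlink] using hij)
    exact add_right_cancel h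
  -- Two arcs over the same edge with distinct sources are opposite darts, hence each follows the
  -- other and the walk has length 2. Its gain would then be twice that of one edge, contradicting
  -- oddness.
  have hedge : Function.Injective fun i => (arc i).1.1.edge := by
    intro i j hij
    rcases (SimpleGraph.dart_edge_eq_iff _ _).1 hij with h | h
    · exact hsrc (congrArg P.left h)
    · by_contra hne
      have h1 : i = j + 1 := hsrc (by simp [← hlink, h])
      have h2 : j = i + 1 := hsrc (by simp [← hlink, h])
      have hk1 : k = 1 := by
        have h3 : (1 + 1 : Fin (k + 1)) = 0 := by
          rw [h2, add_assoc, left_eq_add] at h1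
          exact h1
        rcases k with _ | _ | k
        · exact absurd (Subsingleton.elim (α := Fin 1) i j) hne
        · rfl
        · have h4 := congrArg Fin.val h3
          simp only [Fin.val_add, Fin.val_one, Fin.val_zero] at h4
          rw [Nat.mod_eq_of_lt (by omega)] at h4
          omega
      subst hk1
      have hg : w (arc i).1.1.toEdge = w (arc j).1.1.toEdge := congrArg w (Subtype.ext hij)
      have hg' : w (arc 0).1.1.toEdge = w (arc 1).1.1.toEdge := by
        rw [h2] at hg
        rcases Fin.exists_fin_two.1 ⟨i, rfl⟩ with rfl | rfl
        exacts [hg, hg.symm]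
      obtain ⟨a, b, rfl⟩ := List.length_eq_two.1 hk
      have h0 : w a.1.1.toEdge + (w b.1.1.toEdge + 0) = 1 := hodd
      rw [show w a.1.1.toEdge = w b.1.1.toEdge from hg', add_zero,
        CharTwo.add_self_eq_zero] at h0
      exact zero_ne_one h0
  -- Vertex `i` is the head of arc `i`, so that each vertex takes the color of the arc entering it.
  let γ : DualCycle P.dual :=
    { k := k
      vert := fun i => P.left (arc i).1.1.symm
      edge := fun i => (arc i).1.1.edge
      vert_injective := hvert
      edge_injective := hedge
      isLink := fun i => ⟨(arc i).1.1, rfl, (hlink i).symm, rfl⟩ }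
  have c₀ : S := (arc 0).1.2
  let lam : F → S := Function.extend γ.vert (fun i => (arc i).1.2) fun _ => c₀
  let lamE : Sym2 V → S := Function.extend γ.edge (fun i => (arc i).1.2) fun _ => c₀
  have hlam : ∀ i, lam (γ.vert i) = (arc i).1.2 := hvert.extend_apply _ _
  have hlamE : ∀ i, lamE (γ.edge i) = (arc i).1.2 := hedge.extend_apply _ _
  refine ⟨γ, lam, ?_, ⟨lamE, fun i => ?_, fun i => ?_⟩, ?_⟩
  · refine PlaneEmbedding.not_reachable_of_odd_closed_walk hw hl hodd _ fun a ha => ?_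
    obtain ⟨i, rfl⟩ := hmem a ha
    exact ⟨i, rfl⟩
  · rw [hlamE]
    exact (arc i).2
  · rw [hlam, hlamE]
  · simp only [hlam]
    exact wellBehaved_of_consecutive _ fun i j r hij hjr h => hcons i j r hij hjr (r.isLt.trans_eq hk.symm) h
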